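/- Let $\mathbb{N}=\{1,2,3,\dots\}$. For $A,B\subseteq\mathbb{N}$ and $n\in\mathbb{N}$ put $A-n=\{m\in\mathbb{N} : m+n\in A\}$ and $A-B=\bigcup_{b\in B}(A-b)$ (so $A-\emptyset=\emptyset$). A set $A\subseteq\mathbb{N}$ is thick if for every finite $F\subseteq\mathbb{N}$ there is $n\in\mathbb{N}$ with $F+n\subseteq A$; it is piecewise syndetic if for some $N\in\mathbb{N}$ the set $A\cup(A-1)\cup\cdots\cup(A-N)$ is thick. A minimal system $(X,T)$ is a nonempty compact metric space $X$ with a continuous map $T:X\to X$ such that the only nonempty closed $Y\subseteq X$ with $TY\subseteq Y$ is $Y=X$. A set $A\subseteq\mathbb{N}$ is dynamically thick if for every minimal system $(X,T)$, every $x\in X$ and every nonempty open $U\subseteq X$ there is $n\in A$ with $T^nx\in U$. Theorem. Let $A\subseteq\mathbb{N}$. The following are equivalent. (1) $A$ is dynamically thick. (2) For every piecewise syndetic $S\subseteq\mathbb{N}$ there is a finite set $F\subseteq A$ such that $S-F$ is thick. (3) For every $B$ with $A\subseteq B\subsetneq\mathbb{N}$ there is a finite set $F\subseteq\mathbb{N}\setminus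 B$ such that $B-F$ is thick. -/

import Mathlib

/-! Throughout, the positive integers are `ℕ+`. -/

universe u

namespace DynThick

/-- The translate `A - n = {m : m + n ∈ A}` of a set of positive integers; it consists of
positive integers only. -/
def subNat (A : Set ℕ+) (n : ℕ+) : Set ℕ+ := {m | m + n ∈ A}

/-- The set `A - B`, the union of the translates `A - b` over `b ∈ B` (empty if `B` is). -/
def setSub (A B : Set ℕ+) : Set ℕ+ := ⋃ b ∈ B, subNat A b

/-- `A` is thick: every finite `F` has a translate `F + n`, `n ≥ 1`, inside `A`. -/
def Thick (A : Set ℕ+) : Prop :=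
  ∀ F : Finset ℕ+, ∃ n : ℕ+, ∀ f ∈ F, f + n ∈ A

/-- `A` is piecewise syndetic: for some `N ≥ 1` the union
`A ∪ (A - 1) ∪ ⋯ ∪ (A - N)` is thick. -/
def PiecewiseSyndetic (A : Set ℕ+) : Prop :=
  ∃ N : ℕ+, Thick (A ∪ setSub A (Set.Icc 1 N))

/-- `T` is a continuous self-map of `X`, and the only nonempty closed `Y` with `T Y ⊆ Y` is `X`.
For a nonempty compact metric space `X` this says that `(X, T)` is a minimal system. -/
structure IsMinimalSystem {X : Type*} [TopologicalSpace X] (T : X → X) : Prop where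
  continuous : Continuous T
  eq_univ : ∀ Y : Set X, Y.Nonempty → IsClosed Y → Set.MapsTo T Y Y → Y = Set.univ

/-- `A` is dynamically thick: for every minimal system on a nonempty compact metric space, every
point visits every nonempty open set at some time in `A`. -/
def DynamicallyThick (A : Set ℕ+) : Prop :=
  ∀ (X : Type u) [MetricSpace X] [CompactSpace X] [Nonempty X] (T : X → X),
    IsMinimalSystem T →
      ∀ (x : X) (U : Set X), IsOpen U → U.Nonempty → ∃ n ∈ A, T^[(n : ℕ)] x ∈ U

end DynThick

namespace DynThick

open Set Topology

/-! (1) to (2): limits of windows of `S` contain a minimal subshift meeting the cylinder `y 0 =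
true`. Compactness reduces the hitting times in `A` to a finite `F`, and long prefixes of a point of
the subshift occur in `S`. (2) to (3): if `B` fails (3), finite intersections of translates of `C =
Bᶜ` by its own elements are syndetic. This is enough to build a nonempty uniformly recurrent `D ⊆ C`
(`exists_uniformlyRecurrent`). Such a `D` is syndetic, so (2) gives a finite `F ⊆ A` with `D - F`
thick; recurrence of the initial window of `D` forces `F` to meet `D`, although `A ⊆ B`. (3) to (1):
if the orbit of `x` avoids `U` along `A`, apply (3) to the times outside `U`; bounded-gap returns to
a neighbourhood of `x` contradict thickness. -/

/-! ### Uniformly recurrent subsets, built from words -/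

/-- The word `u`, written from position `a` on, has all its `true` letters in `C`. -/
def FitsAt (C : Set ℕ) (u : List Bool) (a : ℕ) : Prop :=
  ∀ i, u[i]? = some true → a + i ∈ C

/-- Every factor of `u` of length at least `g` contains `v`. -/
def Recurs (v : List Bool) (g : ℕ) (u : List Bool) : Prop :=
  ∀ x, x <:+: u → g ≤ x.length → v <:+: x

theorem FitsAt.append {C : Set ℕ} {u v : List Bool} {a : ℕ} (hu : FitsAt C u a)
    (hv : FitsAt C v (a + u.length)) : FitsAt C (u ++ v) a := by
  intro i hi
  rcases lt_or_ge i u.length with h | h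
  · rw [List.getElem?_append_left h] at hi
    exact hu i hi
  · rw [List.getElem?_append_right h] at hi
    have := hv _ hi
    rwa [show a + u.length + (i - u.length) = a + i by omega] at this

theorem fitsAt_replicate_false (C : Set ℕ) (n a : ℕ) :
    FitsAt C (List.replicate n false) a := by
  intro i hi
  simp [List.getElem?_replicate] at hi

theorem isInfix_append_append {x w y z : List Bool} (h : z <:+: x ++ w ++ y) :
    z <:+: x ++ w ∨ z <:+: w ++ y ∨ w <:+: z := by
  obtain ⟨s, t, h⟩ := h
  rw [List.append_assoc, List.append_assoc, List.append_eq_append_iff] at h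
  rcases h with ⟨a, rfl, h⟩ | ⟨a, rfl, h⟩
  · rw [← List.append_assoc, List.append_eq_append_iff] at h
    rcases h with ⟨b, h, -⟩ | ⟨b, rfl, h⟩
    · left
      exact ⟨s, b, by simp [h]⟩
    · right; right
      exact ⟨a, b, rfl⟩
  · right; left
    exact ⟨a, t, by simp [h]⟩

/-- A factor of `x ++ w ++ y` lies in one of the two overlapping halves or contains all of `w`,
hence `v`. -/
theorem Recurs.glue {v x w y : List Bool} {g : ℕ} (h₁ : Recurs v g (x ++ w))
    (h₂ : Recurs v g (w ++ y)) (hv : v <:+: w) : Recurs v g (x ++ w ++ y) := by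
  intro z hz hg
  rcases isInfix_append_append hz with h | h | h
  · exact h₁ z h hg
  · exact h₂ z h hg
  · exact hv.trans h

/-- A stage of the construction of a uniformly recurrent subset of `C`: an initial word `w`, and
a collection `R` of pairs (word, recurrence bound) which can be respected between any two copies
of `w`. -/
structure IsStage (C : Set ℕ) (w : List Bool) (R : List Bool → ℕ → Prop) : Prop where
  fits : FitsAt C w 0
  pos : 0 < w.length
  isInfix : ∀ v g, R v g → v <:+: w
  recurs : ∀ v g, R v g → Recurs v g w
  fill : ∀ a l, ∃ u : List Bool, u.length = l ∧ FitsAt C u a ∧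
    ∀ v g, R v g → Recurs v g (w ++ u ++ w)

/-- `R` together with the pair `(w, g)`. -/
def addPair (R : List Bool → ℕ → Prop) (w : List Bool) (g : ℕ) : List Bool → ℕ → Prop :=
  fun v h => R v h ∨ v = w ∧ h = g

/-- All finite intersections of translates `C - f`, `f ∈ C`, have bounded gaps. -/
def SyndeticTranslates (C : Set ℕ) : Prop :=
  ∀ F : Finset ℕ, ↑F ⊆ C → ∃ s, ∀ a, ∃ m, a ≤ m ∧ m < a + s ∧ ∀ f ∈ F, m + f ∈ C

theorem SyndeticTranslates.exists_fitsAt {C : Set ℕ} (hC : SyndeticTranslates C) {w : List Bool}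
    (hw : FitsAt C w 0) : ∃ s, ∀ a, ∃ m, a ≤ m ∧ m < a + s ∧ FitsAt C w m := by
  obtain ⟨s, hs⟩ := hC ((Finset.range w.length).filter fun i => w[i]? = some true) (by
    intro i hi
    simpa using hw i (Finset.mem_filter.1 hi).2)
  refine ⟨s, fun a => ?_⟩
  obtain ⟨m, h₁, h₂, h₃⟩ := hs a
  refine ⟨m, h₁, h₂, fun i hi => h₃ i (Finset.mem_filter.2 ⟨?_, hi⟩)⟩
  exact Finset.mem_range.2 (List.getElem?_eq_some_iff.1 hi).1

/-- Copies of `w` fit in `C` with bounded gaps, so a long hole is filled greedily with them; the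
short holes left over use the old `fill`, and `Recurs.glue` joins the pieces at each copy. -/
theorem IsStage.exists_fill {C : Set ℕ} {w : List Bool} {R : List Bool → ℕ → Prop}
    (h : IsStage C w R) {s : ℕ} (hs : ∀ a, ∃ m, a ≤ m ∧ m < a + s ∧ FitsAt C w m) (l : ℕ) :
    ∀ a, ∃ u : List Bool, u.length = l ∧ FitsAt C u a ∧
      ∀ v g, addPair R w (s + 3 * w.length) v g → Recurs v g (w ++ u ++ w) := by
  -- Here `w ++ u ++ w` is shorter than `s + 3 * w.length`, so the new pair holds vacuously.
  have small : ∀ l, l < s + w.length → ∀ a, ∃ u : List Bool, u.length = l ∧ FitsAt C u a ∧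
      ∀ v g, addPair R w (s + 3 * w.length) v g → Recurs v g (w ++ u ++ w) := by
    intro l hl a
    obtain ⟨u, hu, hf, hr⟩ := h.fill a l
    refine ⟨u, hu, hf, ?_⟩
    rintro v g (hv | ⟨rfl, rfl⟩)
    · exact hr v g hv
    · intro x hx hxl
      have := hx.length_le
      simp only [List.length_append] at this
      omega
  induction l using Nat.strong_induction_on with
  | _ l ih =>
    intro a
    rcases lt_or_ge l (s + w.length) with hl | hl
    · exact small l hl a
    obtain ⟨m, hm₁, hm₂, hm⟩ := hs a
    obtain ⟨u₁, hu₁, hf₁, hr₁⟩ := small (m - a) (by omega) a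
    have hpos := h.pos
    obtain ⟨u₂, hu₂, hf₂, hr₂⟩ := ih (l - (m - a) - w.length) (by omega) (m + w.length)
    refine ⟨u₁ ++ w ++ u₂, ?_, ?_, ?_⟩
    · simp only [List.length_append]
      omega
    · refine (hf₁.append ?_).append ?_
      · rwa [hu₁, show a + (m - a) = m by omega]
      · rwa [List.length_append, hu₁, show a + (m - a + w.length) = m + w.length by omega]
    · intro v g hv
      have hvw : v <:+: w := by
        rcases hv with hv | ⟨rfl, -⟩
        · exact h.isInfix v g hv
        · exact List.infix_refl _
      have := Recurs.glue (x := w ++ u₁) (y := u₂ ++ w) (hr₁ v g hv)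
        (by simpa using hr₂ v g hv) hvw
      simpa using this

/-- The next word is `w ++ u ++ w`, the second `w` being placed where it fits in `C`. -/
theorem IsStage.exists_next {C : Set ℕ} (hC : SyndeticTranslates C) {w : List Bool}
    {R : List Bool → ℕ → Prop} (h : IsStage C w R) :
    ∃ w' g, w <+: w' ∧ w.length < w'.length ∧ IsStage C w' (addPair R w g) := by
  obtain ⟨s, hs⟩ := hC.exists_fitsAt h.fits
  have hpos := h.pos
  have hfill := fun a l => h.exists_fill hs l a
  have hinf : ∀ v g, addPair R w (s + 3 * w.length) v g → v <:+: w := by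
    rintro v g (hv | ⟨rfl, -⟩)
    · exact h.isInfix v g hv
    · exact List.infix_refl _
  obtain ⟨m, hm₁, -, hm⟩ := hs w.length
  obtain ⟨u, hu, hf, hr⟩ := hfill w.length (m - w.length)
  refine ⟨w ++ u ++ w, s + 3 * w.length, ⟨u ++ w, by simp⟩, ?_, ?_, ?_, ?_, hr, ?_⟩
  · simp only [List.length_append]
    omega
  · refine (h.fits.append (by simpa using hf)).append ?_
    rwa [List.length_append, hu, show 0 + (w.length + (m - w.length)) = m by omega]
  · simp only [List.length_append]
    omega
  · exact fun v g hv => (hinf v g hv).trans ⟨[], u ++ w, by simp⟩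
  · intro a l
    obtain ⟨u', hu', hf', hr'⟩ := hfill a l
    refine ⟨u', hu', hf', fun v g hv => ?_⟩
    have h₁ := Recurs.glue (x := w ++ u) (y := u' ++ w) (hr v g hv)
      (by simpa using hr' v g hv) (hinf v g hv)
    have h₂ := Recurs.glue (x := w ++ u ++ w ++ u') (y := u ++ w) (by simpa using h₁)
      (by simpa using hr v g hv) (hinf v g hv)
    simpa using h₂

/-- A nonempty set all of whose finite intersections of translates by its own elements have
bounded gaps contains a nonempty uniformly recurrent set. -/
theorem SyndeticTranslates.exists_uniformlyRecurrent {C : Set ℕ} (hC : SyndeticTranslates C)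
    (hne : C.Nonempty) : ∃ D : Set ℕ, D ⊆ C ∧ D.Nonempty ∧
      ∀ L, ∃ g, ∀ p, ∃ m, p ≤ m ∧ m < p + g ∧ ∀ i < L, m + i ∈ D ↔ i ∈ D := by
  obtain ⟨c, hc⟩ := hne
  have h₀ : IsStage C (List.replicate c false ++ [true]) (fun _ _ => False) := by
    refine ⟨?_, by simp, by simp, by simp, fun a l =>
      ⟨List.replicate l false, by simp, fitsAt_replicate_false _ _ _, by simp⟩⟩
    refine (fitsAt_replicate_false _ _ _).append fun i hi => ?_
    obtain rfl : i = 0 := by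
      have := (List.getElem?_eq_some_iff.1 hi).1
      simpa using this
    simpa using hc
  choose next gap hpre hlt hst using
    fun (p : {q : List Bool × (List Bool → ℕ → Prop) // IsStage C q.1 q.2}) =>
      p.2.exists_next hC
  let st : ℕ → {q : List Bool × (List Bool → ℕ → Prop) // IsStage C q.1 q.2} := fun n =>
    Nat.rec ⟨(_, _), h₀⟩ (fun _ p => ⟨(next p, addPair p.1.2 p.1.1 (gap p)), hst p⟩) n
  let w : ℕ → List Bool := fun n => (st n).1.1
  have hpre' : ∀ m n, m ≤ n → w m <+: w n := fun m n hmn => by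
    induction n, hmn using Nat.le_induction with
    | base => exact List.prefix_refl _
    | succ n _ ih => exact ih.trans (hpre (st n))
  have hlen : ∀ n, n < (w n).length := fun n => by
    induction n with
    | zero => exact (st 0).2.pos
    | succ n ih => exact lt_of_le_of_lt (Nat.succ_le_of_lt ih) (hlt (st n))
  have hR : ∀ k n, k < n → (st n).1.2 (w k) (gap (st k)) := fun k n hkn => by
    induction n, Nat.succ_le_of_lt hkn using Nat.le_induction with
    | base => exact Or.inr ⟨rfl, rfl⟩
    | succ n hn ih => exact Or.inl (ih hn)
  have hagree : ∀ m n i, i < (w m).length → i < (w n).length → (w m)[i]? = (w n)[i]? := by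
    have key : ∀ m n i, m ≤ n → i < (w m).length → (w m)[i]? = (w n)[i]? := by
      intro m n i hmn hi
      obtain ⟨t, ht⟩ := hpre' m n hmn
      rw [← ht, List.getElem?_append_left hi]
    intro m n i hm hn
    rcases le_total m n with h | h
    · exact key m n i h hm
    · exact (key n m i h hn).symm
  let D : Set ℕ := {i | ∃ n, (w n)[i]? = some true}
  have hD : ∀ n i, i < (w n).length → (i ∈ D ↔ (w n)[i]? = some true) := by
    intro n i hi
    refine ⟨?_, fun h => ⟨n, h⟩⟩
    rintro ⟨m, hm⟩
    rw [← hagree m n i (List.getElem?_eq_some_iff.1 hm).1 hi, hm]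
  refine ⟨D, ?_, ⟨c, 0, ?_⟩, fun L => ⟨gap (st L), fun p => ?_⟩⟩
  · rintro i ⟨n, hn⟩
    simpa using (st n).2.fits i hn
  · change (List.replicate c false ++ [true])[c]? = some true
    simp
  · set g := gap (st L)
    -- Large enough that `w n` covers the window `[p, p + g)` and that stage `n` respects the pair
    -- of stage `L`.
    set n := p + g + L + 1
    have hn := hlen n
    obtain ⟨s, t, hst⟩ := (st n).2.recurs _ _ (hR L n (by omega)) (((w n).drop p).take g)
      ((List.take_prefix _ _).isInfix.trans (List.drop_suffix _ _).isInfix)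
      (by rw [List.length_take, List.length_drop]; omega)
    have hL := hlen L
    have hlen' := congrArg List.length hst
    simp only [List.length_append, List.length_take, List.length_drop] at hlen'
    refine ⟨p + s.length, by omega, by omega, fun i hi => ?_⟩
    rw [hD n _ (by omega), hD L i (by omega)]
    have : (((w n).drop p).take g)[s.length + i]? = (w L)[i]? := by
      rw [← hst, List.append_assoc, List.getElem?_append_right (by omega),
        List.getElem?_append_left (by omega)]
      congr 1
      omega
    rw [← this, List.getElem?_take_of_lt (by omega), List.getElem?_drop, add_assoc]

/-! ### Minimal subshifts: (1) implies (2) -/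

/-- The nonempty closed sets invariant under `T`. -/
def closedInvariant {X : Type*} [TopologicalSpace X] (T : X → X) : Set (Set X) :=
  {Y | Y.Nonempty ∧ IsClosed Y ∧ MapsTo T Y Y}

theorem exists_minimal_closedInvariant {X : Type*} [TopologicalSpace X] [CompactSpace X]
    {T : X → X} {Y : Set X} (hY : Y ∈ closedInvariant T) :
    ∃ M ⊆ Y, Minimal (· ∈ closedInvariant T) M := by
  refine zorn_superset_nonempty _ (fun c hc hchain hne => ?_) Y hY
  refine ⟨⋂₀ c, ⟨?_, isClosed_sInter fun s hs => (hc hs).2.1, ?_⟩, fun s hs => sInter_subset_of_mem hs⟩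
  · have := hne.to_subtype
    exact IsCompact.nonempty_sInter_of_directed_nonempty_isCompact_isClosed
      (IsChain.directedOn hchain.symm) (fun s hs => (hc hs).1)
      (fun s hs => (hc hs).2.1.isCompact) (fun s hs => (hc hs).2.1)
  · intro x hx s hs
    exact (hc hs).2.2 (hx s hs)

/-- Dynamical thickness, applied to a minimal subset of a metrizable system. -/
theorem DynamicallyThick.exists_iterate_mem {A : Set ℕ+} (hA : DynamicallyThick.{u} A)
    {X : Type} [TopologicalSpace X] [CompactSpace X] [TopologicalSpace.MetrizableSpace X]
    {T : X → X} (hT : Continuous T) {M : Set X} (hM : Minimal (· ∈ closedInvariant T) M)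
    {x : X} (hx : x ∈ M) {U : Set X} (hU : IsOpen U) (hMU : (M ∩ U).Nonempty) :
    ∃ n ∈ A, T^[(n : ℕ)] x ∈ U := by
  let _ : MetricSpace X := TopologicalSpace.metrizableSpaceMetric X
  obtain ⟨hne, hcl, hinv⟩ := hM.prop
  have : CompactSpace M := isCompact_iff_compactSpace.1 hcl.isCompact
  let e : ULift.{u} M → X := fun z => z.down
  have he : Continuous e := continuous_subtype_val.comp continuous_uliftDown
  have hec : IsClosedMap e := he.isClosedMap
  let S : ULift.{u} M → ULift.{u} M := fun z => ⟨hinv.restrict T M M z.down⟩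
  have hS : Function.Semiconj e S T := fun _ => rfl
  have hmin : IsMinimalSystem S := by
    refine ⟨continuous_uliftUp.comp ((hT.continuousOn.mapsToRestrict hinv).comp
      continuous_uliftDown), fun Y hY hYc hYi => ?_⟩
    have h : e '' Y ∈ closedInvariant T := by
      refine ⟨hY.image e, hec Y hYc, ?_⟩
      rintro _ ⟨y, hy, rfl⟩
      exact ⟨S y, hYi hy, rfl⟩
    have hsub : M ⊆ e '' Y := hM.le_of_le h (by
      rintro _ ⟨y, -, rfl⟩
      exact y.down.2)
    refine eq_univ_of_forall fun z => ?_
    obtain ⟨y, hy, hyz⟩ := hsub z.down.2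
    rwa [show z = y from ULift.ext _ _ (Subtype.ext hyz.symm)]
  obtain ⟨y, hyM, hyU⟩ := hMU
  have : Nonempty (ULift.{u} M) := ⟨⟨⟨x, hx⟩⟩⟩
  obtain ⟨n, hn, hnU⟩ := hA (ULift.{u} M) S hmin ⟨⟨x, hx⟩⟩ (e ⁻¹' U) (hU.preimage he)
    ⟨⟨⟨y, hyM⟩⟩, hyU⟩
  refine ⟨n, hn, ?_⟩
  have := hS.iterate_right n ⟨⟨x, hx⟩⟩
  rw [mem_preimage, this] at hnU
  exact hnU

/-- The shift on sequences. -/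
def shift (y : ℕ → Bool) : ℕ → Bool := fun i => y (i + 1)

theorem continuous_shift : Continuous shift := by
  unfold shift
  fun_prop

theorem iterate_shift (n : ℕ) (y : ℕ → Bool) (i : ℕ) : shift^[n] y i = y (i + n) := by
  induction n generalizing y with
  | zero => rfl
  | succ n ih => rw [Function.iterate_succ_apply, ih]; simp only [shift, add_assoc]

/-- The sequences whose first `L` letters occur in `S`, with at least one `true` in each block of
`N + 1` letters starting there. -/
def patterns (S : Set ℕ+) (N L : ℕ) : Set (ℕ → Bool) :=
  {y | (∃ m : ℕ+, ∀ i < L, y i = true ↔ ∃ s ∈ S, (s : ℕ) = m + i) ∧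
    ∀ i < L, ∃ j ≤ N, y (i + j) = true}

theorem isClosed_patterns (S : Set ℕ+) (N L : ℕ) : IsClosed (patterns S N L) := by
  have h₁ : IsClosed {y : ℕ → Bool | ∃ m : ℕ+, ∀ i < L, y i = true ↔ ∃ s ∈ S, (s : ℕ) = m + i} := by
    have hr : Continuous fun (y : ℕ → Bool) (i : Fin L) => y i := by fun_prop
    convert (isClosed_discrete
      {z : Fin L → Bool | ∃ m : ℕ+, ∀ i, z i = true ↔ ∃ s ∈ S, (s : ℕ) = m + i}).preimage hr using 1
    ext y
    simp [Fin.forall_iff]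
  have h₂ : IsClosed {y : ℕ → Bool | ∀ i < L, ∃ j ≤ N, y (i + j) = true} := by
    have : {y : ℕ → Bool | ∀ i < L, ∃ j ≤ N, y (i + j) = true} =
        ⋂ i ∈ Iio L, ⋃ j ∈ Iic N, {y : ℕ → Bool | y (i + j) = true} := by
      ext y
      simp
    rw [this]
    refine isClosed_biInter fun i _ => (finite_Iic N).isClosed_biUnion fun j _ => ?_
    exact isClosed_eq (continuous_apply _) continuous_const
  exact h₁.inter h₂

theorem patterns_anti (S : Set ℕ+) (N L : ℕ) : patterns S N (L + 1) ⊆ patterns S N L := by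
  rintro y ⟨⟨m, hm⟩, h⟩
  exact ⟨⟨m, fun i hi => hm i (by omega)⟩, fun i hi => h i (by omega)⟩

theorem shift_mem_patterns {S : Set ℕ+} {N L : ℕ} {y : ℕ → Bool}
    (hy : y ∈ patterns S N (L + 1)) : shift y ∈ patterns S N L := by
  obtain ⟨⟨m, hm⟩, h⟩ := hy
  refine ⟨⟨m + 1, fun i hi => ?_⟩, fun i hi => ?_⟩
  · rw [shift, hm (i + 1) (by omega)]
    simp only [PNat.add_coe, PNat.one_coe, add_assoc, add_comm 1]
  · obtain ⟨j, hj, hij⟩ := h (i + 1) (by omega)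
    exact ⟨j, hj, by rwa [shift, add_right_comm]⟩

theorem PiecewiseSyndetic.exists_patterns_nonempty {S : Set ℕ+} (hS : PiecewiseSyndetic S) :
    ∃ N, ∀ L, (patterns S N L).Nonempty := by
  classical
  obtain ⟨N, hN⟩ := hS
  refine ⟨N, fun L => ?_⟩
  obtain ⟨m, hm⟩ := hN (Finset.Icc 1 (Nat.succPNat L))
  -- Index `i` starts at 0 but thickness concerns `f ≥ 1`, so `f = i + 1` and the window starts at
  -- `m + 1`.
  refine ⟨fun i => decide (∃ s ∈ S, (s : ℕ) = ((m + 1 : ℕ+) : ℕ) + i),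
    ⟨m + 1, fun i _ => decide_eq_true_iff⟩, fun i hi => ?_⟩
  have := hm (Nat.succPNat i) (Finset.mem_Icc.2 ⟨one_le, Nat.succPNat_le_succPNat.2 hi.le⟩)
  simp only [decide_eq_true_eq]
  rcases this with h | h
  · refine ⟨0, Nat.zero_le _, _, h, ?_⟩
    simp
    omega
  · simp only [setSub, subNat, mem_iUnion, mem_Icc, mem_ofPred_eq] at h
    obtain ⟨j, ⟨-, hj⟩, h⟩ := h
    refine ⟨j, hj, _, h, ?_⟩
    simp
    omega

theorem DynamicallyThick.exists_thick_setSub {A : Set ℕ+} (hA : DynamicallyThick.{u} A)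
    {S : Set ℕ+} (hS : PiecewiseSyndetic S) :
    ∃ F : Finset ℕ+, (F : Set ℕ+) ⊆ A ∧ Thick (setSub S F) := by
  obtain ⟨N, hN⟩ := hS.exists_patterns_nonempty
  have hY : (⋂ L, patterns S N L) ∈ closedInvariant shift := by
    refine ⟨IsCompact.nonempty_iInter_of_sequence_nonempty_isCompact_isClosed _
      (patterns_anti S N) hN (isClosed_patterns S N 0).isCompact (isClosed_patterns S N),
      isClosed_iInter (isClosed_patterns S N), fun y hy => ?_⟩
    exact mem_iInter.2 fun L => shift_mem_patterns (mem_iInter.1 hy (L + 1))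
  obtain ⟨M, hMY, hM⟩ := exists_minimal_closedInvariant hY
  obtain ⟨⟨y, hy⟩, hMc, hMi⟩ := hM.prop
  have hU : IsOpen {z : ℕ → Bool | z 0 = true} :=
    (isOpen_discrete ({true} : Set Bool)).preimage (f := fun z : ℕ → Bool => z 0) (by fun_prop)
  have hMU : (M ∩ {z : ℕ → Bool | z 0 = true}).Nonempty := by
    obtain ⟨j, -, hj⟩ := (mem_iInter.1 (hMY hy) 1).2 0 one_pos
    refine ⟨shift^[j] y, hMi.iterate j hy, ?_⟩
    rw [mem_ofPred_eq, iterate_shift]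
    exact hj
  obtain ⟨F, hFA, hF⟩ := hMc.isCompact.elim_finite_subcover_image
    (b := A) (c := fun n : ℕ+ => shift^[(n : ℕ)] ⁻¹' {z | z 0 = true})
    (fun n _ => hU.preimage (continuous_shift.iterate n)) (fun z hz => by
      obtain ⟨n, hn, h⟩ := hA.exists_iterate_mem continuous_shift hM hz hU hMU
      exact mem_biUnion hn h)
  obtain ⟨hFfin, hF⟩ := hF
  refine ⟨hFfin.toFinset, by simpa using hFA, fun G => ?_⟩
  obtain ⟨f₀, hf₀⟩ := hFfin.bddAbove
  obtain ⟨g₀, hg₀⟩ := G.bddAbove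
  obtain ⟨⟨m, hm⟩, -⟩ := mem_iInter.1 (hMY hy) (f₀ + g₀ + 1 : ℕ)
  refine ⟨m, fun g hg => ?_⟩
  obtain ⟨f, hf, h⟩ := mem_iUnion₂.1 (hF (hMi.iterate g hy))
  rw [mem_preimage, mem_ofPred_eq, iterate_shift, iterate_shift] at h
  have h₁ : (f : ℕ) ≤ f₀ := hf₀ hf
  have h₂ : (g : ℕ) ≤ g₀ := hg₀ hg
  obtain ⟨s, hs, hsm⟩ := (hm _ (by omega)).1 h
  refine mem_biUnion (by simpa using hf) ?_
  have : s = g + m + f := by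
    apply PNat.eq
    push_cast
    omega
  rwa [subNat, mem_ofPred_eq, ← this]

/-! ### Recurrence in the complement: (2) implies (3) -/

theorem exists_thick_setSub_of_superset {A : Set ℕ+}
    (hA : ∀ S : Set ℕ+, PiecewiseSyndetic S →
      ∃ F : Finset ℕ+, (F : Set ℕ+) ⊆ A ∧ Thick (setSub S F))
    {B : Set ℕ+} (hAB : A ⊆ B) (hB : B ≠ univ) :
    ∃ F : Finset ℕ+, (F : Set ℕ+) ⊆ Bᶜ ∧ Thick (setSub B F) := by
  classical
  by_contra! hcon
  let C : Set ℕ := (fun n : ℕ+ => (n : ℕ)) '' Bᶜ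
  have hC : SyndeticTranslates C := by
    intro F hF
    obtain ⟨F', hF', rfl⟩ := Finset.subset_set_image_iff.1 hF
    have := hcon F' hF'
    simp only [Thick, not_forall, not_exists] at this
    obtain ⟨G, hG⟩ := this
    obtain ⟨g₀, hg₀⟩ := G.bddAbove
    refine ⟨g₀ + 2, fun a => ?_⟩
    obtain ⟨g, hg, hgB⟩ := hG (Nat.succPNat a)
    have hg₁ : (g : ℕ) ≤ g₀ := hg₀ hg
    refine ⟨g + Nat.succPNat a, by simp; omega, by simp; omega, ?_⟩
    simp only [Finset.mem_image]
    rintro _ ⟨f, hf, rfl⟩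
    refine ⟨g + Nat.succPNat a + f, fun h => hgB (mem_biUnion (Finset.mem_coe.2 hf) h), ?_⟩
    simp
  obtain ⟨b, hb⟩ := (ne_univ_iff_exists_notMem B).1 hB
  obtain ⟨D, hDC, ⟨d, hd⟩, hD⟩ := hC.exists_uniformlyRecurrent ⟨b, b, hb, rfl⟩
  have hS : PiecewiseSyndetic {n : ℕ+ | (n : ℕ) ∈ D} := by
    obtain ⟨g, hg⟩ := hD (d + 1)
    refine ⟨Nat.succPNat (g + d), fun F => ⟨1, fun f _ => ?_⟩⟩
    obtain ⟨m, hm₁, hm₂, hm⟩ := hg (f + 2)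
    have hmd := (hm d (by omega)).2 hd
    have hf := f.pos
    obtain ⟨k, hk⟩ : ∃ k : ℕ+, (k : ℕ) = m + d - (f + 1) := ⟨⟨_, by omega⟩, rfl⟩
    refine Or.inr (mem_biUnion (x := k) ⟨one_le, ?_⟩ ?_)
    · rw [← PNat.coe_le_coe, Nat.succPNat_coe]
      omega
    · simp only [subNat, mem_ofPred_eq, PNat.add_coe, PNat.one_coe]
      rwa [show (f : ℕ) + 1 + k = m + d by omega]
  obtain ⟨F, hFA, hF⟩ := hA _ hS
  obtain ⟨f₀, hf₀⟩ := F.bddAbove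
  -- The window `[0, f₀]` contains `F`, so at each of its returns `m`, `m + f ∈ D` exactly when `f ∈
  -- D`.
  obtain ⟨g, hg⟩ := hD (f₀ + 1)
  obtain ⟨n, hn⟩ := hF (Finset.Icc 1 (Nat.succPNat g))
  obtain ⟨m, hm₁, hm₂, hm⟩ := hg (n + 1)
  obtain ⟨k, hk⟩ : ∃ k : ℕ+, (k : ℕ) = m - n := ⟨⟨_, by omega⟩, rfl⟩
  have hkn := hn k (Finset.mem_Icc.2 ⟨one_le, by
    rw [← PNat.coe_le_coe, Nat.succPNat_coe]
    omega⟩)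
  obtain ⟨f, hf, h⟩ := mem_iUnion₂.1 hkn
  have hff : (f : ℕ) ≤ f₀ := hf₀ hf
  simp only [subNat, mem_ofPred_eq, PNat.add_coe] at h
  rw [show (k : ℕ) + n + f = m + f by omega, hm f (by omega)] at h
  obtain ⟨f', hf', hff'⟩ := hDC h
  rw [PNat.coe_injective hff'] at hf'
  exact hf' (hAB (hFA hf))

/-! ### Return times: (3) implies (1) -/

theorem IsMinimalSystem.exists_iterate_mem {X : Type*} [TopologicalSpace X] {T : X → X}
    (hT : IsMinimalSystem T) (x : X) {U : Set X} (hU : IsOpen U) (hne : U.Nonempty) :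
    ∃ n : ℕ+, T^[(n : ℕ)] x ∈ U := by
  have h := hT.eq_univ (closure (range fun n : ℕ+ => T^[(n : ℕ)] x))
    ((range_nonempty _).closure) isClosed_closure (MapsTo.closure (by
      rintro _ ⟨n, rfl⟩
      refine ⟨n + 1, ?_⟩
      simp [Function.iterate_succ_apply']) hT.continuous)
  obtain ⟨y, hy⟩ := hne
  obtain ⟨_, hz, n, rfl⟩ := mem_closure_iff.1 (h ▸ mem_univ y) U hU hy
  exact ⟨n, hz⟩

theorem dynamicallyThick_of_exists_thick_setSub {A : Set ℕ+}
    (hA : ∀ B : Set ℕ+, A ⊆ B → B ≠ univ →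
      ∃ F : Finset ℕ+, (F : Set ℕ+) ⊆ Bᶜ ∧ Thick (setSub B F)) : DynamicallyThick.{u} A := by
  intro X _ _ _ T hT x U hU hne
  by_contra! hcon
  obtain ⟨n₀, hn₀⟩ := hT.exists_iterate_mem x hU hne
  obtain ⟨F, hFB, hF⟩ := hA {n | T^[(n : ℕ)] x ∉ U} hcon
    ((ne_univ_iff_exists_notMem _).2 ⟨n₀, fun h => h hn₀⟩)
  -- If `T^k x ∈ V`, then `k + f` is outside the avoiding set for every `f ∈ F`. By compactness,
  -- finitely many times `G` suffice to bring any point into `V`.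
  let V : Set X := ⋂ f ∈ F, T^[((f : ℕ+) : ℕ)] ⁻¹' U
  have hV : IsOpen V := isOpen_biInter_finset fun f _ => hU.preimage (hT.continuous.iterate f)
  have hxV : x ∈ V := mem_iInter₂.2 fun f hf => not_not.1 (hFB hf)
  obtain ⟨G, hG⟩ := isCompact_univ.elim_finite_subcover (fun n : ℕ+ => T^[(n : ℕ)] ⁻¹' V)
    (fun n => hV.preimage (hT.continuous.iterate n))
    (fun y _ => mem_iUnion.2 (hT.exists_iterate_mem y hV ⟨x, hxV⟩))
  obtain ⟨m, hm⟩ := hF G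
  obtain ⟨g, hg, h⟩ := mem_iUnion₂.1 (hG (mem_univ (T^[(m : ℕ)] x)))
  obtain ⟨f, hf, hfB⟩ := mem_iUnion₂.1 (hm g hg)
  refine hfB ?_
  have := mem_iInter₂.1 h f hf
  rw [mem_preimage, ← Function.iterate_add_apply, ← Function.iterate_add_apply] at this
  convert this using 2
  push_cast
  omega

end DynThick

theorem theoremB (A : Set ℕ+) :
    List.TFAE
      [DynThick.DynamicallyThick.{u} A,
       ∀ S : Set ℕ+, DynThick.PiecewiseSyndetic S →
         ∃ F : Finset ℕ+, (F : Set ℕ+) ⊆ A ∧ DynThick.Thick (DynThick.setSub S F),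
       ∀ B : Set ℕ+, A ⊆ B → B ≠ Set.univ →
         ∃ F : Finset ℕ+, (F : Set ℕ+) ⊆ Bᶜ ∧ DynThick.Thick (DynThick.setSub B F)] := by
  tfae_have 1 → 2 := fun h _ hS => h.exists_thick_setSub hS
  tfae_have 2 → 3 := fun h _ hAB hB => DynThick.exists_thick_setSub_of_superset h hAB hB
  tfae_have 3 → 1 := DynThick.dynamicallyThick_of_exists_thick_setSub
  tfae_finish
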